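/- Let $\alpha\in(0,1)$, $q>\alpha$ and $\gamma\in(0,q)$. Let $(\kappa(x,\cdot))_{x>0}$ be a family of probability laws, $\kappa(x,\cdot)$ being carried by the continuous nonnegative paths $(z(s),0\le s\le x)$ with $z(0)=z(x)=0$, which is self-similar: if $Z$ has law $\kappa(1,\cdot)$, then $(x^qZ(s/x),0\le s\le x)$ has law $\kappa(x,\cdot)$. Suppose that, for $Z$ with law $\kappa(1,\cdot)$, the Hölder constant $D_\gamma=\sup_{0\le r<s\le 1}|Z(s)-Z(r)|/|s-r|^\gamma$ has finite moments of all orders, and that $c=\frac{1+\alpha}{\Gamma(1-\alpha)}\mathbb{E}\big(Z(U)^{\alpha/q}\big)>0$, where $U$ is uniform on $[0,1]$ and independent of $Z$. Let $X=(X_t,t\ge 0)$ be a spectrally positive stable Lévy process with $\mathbb{E}(e^{-\eta X_t})=e^{t\eta^{1+\alpha}}$ for all $\eta,t\ge 0$. Write $\Delta X_t=X_t-X_{t-}$, and let the jumps $(t,\Delta X_t)$, $\Delta X_t>0$, be marked by random paths $Z_t=(Z_t(s),0\le s\le\Delta X_t)$ which, conditionally given $X$, are independent with respective laws $\kappa(\Delta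 X_t,\cdot)$. Then, almost surely, for all $T>0$, $$D_{[0,T]}:=\sup_{0\le t\le T}\ \sup_{0\le x<y\le\Delta X_t}\frac{|Z_t(y)-Z_t(x)|}{|y-x|^\gamma}<\infty,$$ although the total length of the jump intervals is infinite: almost surely, $\sum_{0\le t\le T}\Delta X_t=\infty$ for all $T>0$. -/

import Mathlib

open MeasureTheory ProbabilityTheory Filter Topology Set
open scoped NNReal ENNReal

noncomputable section

namespace MarkedStable

/-! ### Càdlàg paths, jumps, Lévy processes -/

/-- `f` is right-continuous with left limits. (At time `0` the left-limit requirement is void.) -/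
def IsCadlag (f : ℝ≥0 → ℝ) : Prop :=
  ∀ t, ContinuousWithinAt f (Ici t) t ∧ ∃ l, Tendsto f (𝓝[<] t) (𝓝 l)

/-- The jump `f t - f (t-)` of a path at time `t`; it is `0` at time `0`. -/
def jump (f : ℝ≥0 → ℝ) (t : ℝ≥0) : ℝ :=
  f t - Function.leftLim f t

/-- A real-valued Lévy process: it starts from `0`, has independent and stationary increments,
and has càdlàg paths almost surely. -/
structure IsLevyProcess {Ω : Type*} [MeasurableSpace Ω] (P : Measure Ω)
    (X : ℝ≥0 → Ω → ℝ) : Prop where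
  measurable : ∀ t, Measurable (X t)
  start : ∀ᵐ ω ∂P, X 0 ω = 0
  indep : HasIndepIncrements X P
  stationary : ∀ s t, IdentDistrib (fun ω => X (s + t) ω - X s ω) (X t) P P
  cadlag : ∀ᵐ ω ∂P, IsCadlag (fun t => X t ω)

/-- A spectrally positive stable Lévy process with Laplace exponent `ψ(η) = η ^ (1 + α)`, that is,
`E (exp (-η X_t)) = exp (t * η ^ (1 + α))` for `η ≥ 0`. -/
structure IsSpectrallyPositiveStable {Ω : Type*} [MeasurableSpace Ω] (P : Measure Ω)
    (α : ℝ) (X : ℝ≥0 → Ω → ℝ) : Prop where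
  levy : IsLevyProcess P X
  jump_nonneg : ∀ᵐ ω ∂P, ∀ t, 0 ≤ jump (fun s => X s ω) t
  laplace : ∀ (t : ℝ≥0) (η : ℝ), 0 ≤ η → mgf (X t) P (-η) = Real.exp (t * η ^ (1 + α))

/-! ### Marks -/

/-- The space of marks: continuous nonnegative functions on the line, with the σ-algebra generated
by the evaluation maps. A path indexed by `[0, x]` that vanishes at `0` and at `x` is regarded as
a function on the line through the convention that it vanishes outside `(0, x)`. -/
abbrev MarkPath : Type := {f : ℝ → ℝ // Continuous f ∧ ∀ s, 0 ≤ f s}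

/-- The rescaled path `s ↦ x ^ q * f (s / x)`. -/
def scalePath (q : ℝ) (x : ℝ≥0) (f : MarkPath) : MarkPath :=
  ⟨fun s => (x : ℝ) ^ q * f.1 (s / x),
    continuous_const.mul (f.2.1.comp (continuous_id.div_const _)),
    fun _ => mul_nonneg (Real.rpow_nonneg x.2 q) (f.2.2 _)⟩

/-- `κ x` is the law of the mark of a jump of size `x`: it is carried by paths on `[0, x]` that
vanish at both ends, and it is self-similar with parameter `q`, that is, if `Z` has law `κ 1`,
then `(x ^ q * Z (s / x), 0 ≤ s ≤ x)` has law `κ x`. -/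
structure IsSelfSimilarMarking (q : ℝ) (κ : Kernel ℝ≥0 MarkPath) : Prop where
  supp : ∀ x : ℝ≥0, ∀ᵐ f ∂(κ x), ∀ s, s ∉ Ioo (0 : ℝ) x → f.1 s = 0
  scaling : ∀ x : ℝ≥0, 0 < x → κ x = (κ 1).map (scalePath q x)

/-- The `γ`-Hölder constant of `f` on `[0, x]`, as an element of `[0, ∞]`;
it is `0` when `x ≤ 0`. -/
def holderConst (γ x : ℝ) (f : ℝ → ℝ) : ℝ≥0∞ :=
  ⨆ (r : ℝ) (s : ℝ) (_ : 0 ≤ r ∧ r < s ∧ s ≤ x), ENNReal.ofReal (|f s - f r| / |s - r| ^ γ)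

/-- The constant `c = (1 + α) / Γ(1 - α) * E (Z(U) ^ (α / q))`, where `Z` has law `κ 1` and `U` is
uniform on `[0, 1]` and independent of `Z`. -/
def crossingConst (α q : ℝ) (κ : Kernel ℝ≥0 MarkPath) : ℝ≥0∞ :=
  ENNReal.ofReal ((1 + α) / Real.Gamma (1 - α)) *
    ∫⁻ p : MarkPath × ℝ, ENNReal.ofReal (p.1.1 p.2 ^ (α / q))
      ∂((κ 1).prod (volume.restrict (Icc (0 : ℝ) 1)))

/-- The σ-algebra generated by the process `X`. -/
abbrev processSigma {Ω : Type*} (X : ℝ≥0 → Ω → ℝ) : MeasurableSpace Ω :=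
  ⨆ t, MeasurableSpace.comap (X t) inferInstance

/-- `Z` is a family of `κ`-marks for the jumps of `X`: given `X`, the marks `Z t` of the jumps
`(t, ΔX_t)` are independent, with respective laws `κ (ΔX_t)`. The random countable set of jump
times is handled through a list `τ 0, τ 1, …` of distinct times which depends measurably on `X` and
contains all jump times. (Listed times that are not jump times receive the law `κ 0`, the unit mass
at the zero path.) -/
def IsMarking {Ω : Type*} [MeasurableSpace Ω] (P : Measure Ω) (κ : Kernel ℝ≥0 MarkPath)
    (X : ℝ≥0 → Ω → ℝ) (Z : ℝ≥0 → Ω → MarkPath) : Prop :=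
  ∃ τ : ℕ → Ω → ℝ≥0,
    (∀ n, Measurable[processSigma X] (τ n)) ∧
    (∀ᵐ ω ∂P, Function.Injective (fun n => τ n ω) ∧
      ∀ t, jump (fun s => X s ω) t ≠ 0 → ∃ n, τ n ω = t) ∧
    (∀ n, Measurable (fun ω => Z (τ n ω) ω)) ∧
    ∀ (N : ℕ) (A : ℕ → Set MarkPath), (∀ n, MeasurableSet (A n)) →
      P⟦{ω | ∀ n < N, Z (τ n ω) ω ∈ A n} | processSigma X⟧ =ᵐ[P]
        fun ω => ∏ n ∈ Finset.range N,
          (κ (jump (fun s => X s ω) (τ n ω)).toNNReal).real (A n)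

end MarkedStable

end

namespace MarkedStable

/-! The Lévy measure is never introduced; the jumps are reached through the sums `gridSum` of `expSq
(η * ·)` over the increments along finer and finer partitions of `[0, T]`. Expanding the square
turns their moments into Laplace transforms: the mean tends to `T * η ^ (1 + α) * (2 ^ (1 + α) -
2)`, and the variance is asymptotically at most a constant times `η ^ (1 + α)`.

Hölder bound. By Fatou, the expected sum of `expSq` over the jumps in `[0, T]` is finite
(`tsum_expSq_jump_le_liminf`, `lintegral_liminf_gridSum_lt_top`). By self-similarity the Hölder
constant of a mark of length `x` is `x ^ (q - γ)` times one of law `κ 1`, so Markov's inequality at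
order `2 / (q - γ)` shows that it exceeds `1` with probability at most `C * expSq x`
(`exists_exceedSet_le`). By Borel–Cantelli only finitely many marks up to a given time exceed `1`,
and each of these has a finite constant.

Infinite length. If the jumps in `[0, T]` summed to at most `K`, then on fine partitions each
increment would be, up to `ε = 1 / m`, between `0` and the jump mass of its cell, whence `gridSum`
at `η` is at most `64 * η * K` plus `576 * (η / m) ^ 2` times `gridSum` at `m`
(`eventually_gridSum_le`). The left side concentrates at order `η ^ (1 + α)`, which beats `η * K`
for large `η`; the last term has mean of order `η ^ 2 * m ^ (α - 1)`, which vanishes as `m → ∞`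
because `α < 1` (`exists_scales`, `jumpMeasure_le_null`). -/

/-! ### The test function -/

/-- The test function `y ↦ (1 - exp (-y)) ^ 2`: quadratic near `0`, and its expectation along the
process only involves the Laplace transform. -/
noncomputable def expSq (y : ℝ) : ℝ := (1 - Real.exp (-y)) ^ 2

lemma expSq_nonneg (y : ℝ) : 0 ≤ expSq y := sq_nonneg _

lemma continuous_expSq : Continuous expSq := by unfold expSq; fun_prop

lemma expSq_le_self {y : ℝ} (hy : 0 ≤ y) : expSq y ≤ y := by
  have h1 := Real.add_one_le_exp (-y)
  have h2 := Real.exp_pos (-y)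
  have h3 : Real.exp (-y) ≤ 1 := Real.exp_le_one_iff.2 (by linarith)
  unfold expSq
  nlinarith

lemma expSq_le_sq {y : ℝ} (hy : -2 ≤ y) : expSq y ≤ 64 * y ^ 2 := by
  have h1 := Real.add_one_le_exp (-y)
  have h2 := Real.exp_pos (-y)
  have key : |1 - Real.exp (-y)| ≤ 8 * |y| := by
    rcases le_total 0 y with h | h
    · have h3 : Real.exp (-y) ≤ 1 := Real.exp_le_one_iff.2 (by linarith)
      rw [abs_of_nonneg (by linarith), abs_of_nonneg h]
      linarith
    · have h3 : 1 ≤ Real.exp (-y) := Real.one_le_exp (by linarith)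
      have h4 : Real.exp (-y) ≤ 8 := by
        calc Real.exp (-y) ≤ Real.exp 2 := Real.exp_le_exp.2 (by linarith)
          _ = Real.exp 1 * Real.exp 1 := by rw [← Real.exp_add]; norm_num
          _ ≤ 8 := by nlinarith [Real.exp_one_lt_d9, Real.exp_pos 1]
      have h5 := Real.add_one_le_exp y
      have h6 : Real.exp (-y) * Real.exp y = 1 := by rw [← Real.exp_add]; simp
      rw [abs_of_nonpos (by linarith), abs_of_nonpos h]
      nlinarith
  calc expSq y = |1 - Real.exp (-y)| ^ 2 := by rw [sq_abs]; rfl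
    _ ≤ (8 * |y|) ^ 2 := by gcongr
    _ = 64 * y ^ 2 := by rw [mul_pow, sq_abs]; norm_num

lemma div_one_add_le_one_sub_exp_neg {y : ℝ} (hy : 0 ≤ y) : y / (1 + y) ≤ 1 - Real.exp (-y) := by
  have h1 := Real.add_one_le_exp y
  have h6 : Real.exp (-y) * Real.exp y = 1 := by rw [← Real.exp_add]; simp
  have h2 := Real.exp_pos (-y)
  rw [div_le_iff₀ (by linarith)]
  nlinarith

lemma sq_le_expSq {y : ℝ} (hy : |y| ≤ 2) : y ^ 2 ≤ 9 * expSq y := by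
  have key : |y| ≤ 3 * |1 - Real.exp (-y)| := by
    rcases le_total 0 y with h | h
    · have h1 := div_one_add_le_one_sub_exp_neg h
      rw [abs_of_nonneg h] at hy ⊢
      have h2 : y / 3 ≤ y / (1 + y) := by gcongr; linarith
      linarith [le_abs_self (1 - Real.exp (-y))]
    · have h1 := Real.add_one_le_exp (-y)
      rw [abs_of_nonpos h]
      linarith [neg_abs_le (1 - Real.exp (-y))]
  calc y ^ 2 = |y| ^ 2 := (sq_abs y).symm
    _ ≤ (3 * |1 - Real.exp (-y)|) ^ 2 := by gcongr
    _ = 9 * expSq y := by rw [mul_pow, sq_abs]; norm_num [expSq]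

lemma min_one_sq_le_expSq {y : ℝ} (hy : 0 ≤ y) : min 1 (y ^ 2) ≤ 9 * expSq y := by
  rcases le_total y 2 with h | h
  · exact (min_le_right _ _).trans (sq_le_expSq (by rwa [abs_of_nonneg hy]))
  · refine (min_le_left _ _).trans ?_
    have h1 := div_one_add_le_one_sub_exp_neg hy
    have h2 : 1 / 3 ≤ y / (1 + y) := by rw [div_le_div_iff₀] <;> linarith
    unfold expSq
    nlinarith

/-- Compares an increment with the jump mass `b` it may contain, up to an `ε`-small part. -/
lemma expSq_mul_le {η ε a b : ℝ} (hη : 0 < η) (hε : 0 < ε) (hηε : η * ε ≤ 1) (ha : -ε ≤ a)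
    (hab : a ≤ ε + b) (hb : 0 ≤ b) :
    expSq (η * a) ≤ 64 * η * b + 576 * (η * ε) ^ 2 * expSq (a / ε) := by
  have hηε0 : 0 < η * ε := by positivity
  have h0 : 0 ≤ 576 * (η * ε) ^ 2 * expSq (a / ε) := by
    have := expSq_nonneg (a / ε)
    positivity
  have hlow : -(η * ε) ≤ η * a := by nlinarith
  -- If `b ≤ ε`, then `|a| ≤ 2 * ε`, where `expSq (a / ε)` is comparable to a square; `576 = 64 *
  -- 9`. If `ε ≤ b`, the jump term alone suffices.
  rcases le_total b ε with hbε | hbε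
  · have h1 : expSq (η * a) ≤ 64 * (η * a) ^ 2 := expSq_le_sq (by linarith)
    have h2 : (a / ε) ^ 2 ≤ 9 * expSq (a / ε) := by
      apply sq_le_expSq
      rw [abs_div, abs_of_pos hε, div_le_iff₀ hε, abs_le]
      constructor <;> linarith
    have h3 : η * a = η * ε * (a / ε) := by field_simp
    have h4 : (η * a) ^ 2 = (η * ε) ^ 2 * (a / ε) ^ 2 := by rw [h3]; ring
    have h5 : 0 ≤ 64 * η * b := by positivity
    have h6 : (η * ε) ^ 2 * (a / ε) ^ 2 ≤ (η * ε) ^ 2 * (9 * expSq (a / ε)) := by gcongr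
    linarith
  · rcases le_total 0 a with h | h
    · have h1 : expSq (η * a) ≤ η * a := expSq_le_self (by positivity)
      nlinarith [mul_nonneg hη.le hb]
    · have h1 : expSq (η * a) ≤ 64 * (η * a) ^ 2 := expSq_le_sq (by linarith)
      have h2 : (η * a) ^ 2 ≤ (η * ε) ^ 2 := by
        apply sq_le_sq'
        · linarith
        · nlinarith
      have h3 : (η * ε) ^ 2 ≤ η * b := by nlinarith
      linarith

/-- Gives the limit of a sum of `n + 1` identical contributions from cells of length proportional to
`1 / (n + 1)`. -/
lemma tendsto_mul_comp_div {g : ℝ → ℝ} {g' : ℝ} (hg : HasDerivAt g g' 0) (h0 : g 0 = 0) (c : ℝ) :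
    Tendsto (fun n : ℕ => ((n : ℝ) + 1) * g (c / (n + 1))) atTop (𝓝 (c * g')) := by
  rcases eq_or_ne c 0 with rfl | hc
  · simp [h0]
  have h1 := hg.tendsto_slope
  have h2 : Tendsto (fun n : ℕ => c / ((n : ℝ) + 1)) atTop (𝓝[≠] 0) := by
    rw [tendsto_nhdsWithin_iff]
    refine ⟨?_, Eventually.of_forall fun n => ?_⟩
    · have := (tendsto_one_div_add_atTop_nhds_zero_nat (𝕜 := ℝ)).const_mul c
      simpa [div_eq_mul_inv] using this
    · simp only [mem_compl_iff, mem_singleton_iff]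
      positivity
  refine ((h1.comp h2).const_mul c).congr fun n => ?_
  have hn : (n : ℝ) + 1 ≠ 0 := by positivity
  have hx : c / ((n : ℝ) + 1) ≠ 0 := div_ne_zero hc hn
  simp only [Function.comp, slope_def_field, h0, sub_zero]
  generalize g (c / ((n : ℝ) + 1)) = y at *
  field_simp

/-! ### Laplace functionals of the increments -/

/-- The expectation of `expSq (η * X_t)` as a function of `t * η ^ (1 + α)`. -/
noncomputable def meanFun (α θ : ℝ) : ℝ := 1 - 2 * Real.exp θ + Real.exp (2 ^ (1 + α) * θ)

/-- The expectation of `expSq (η * X_t) ^ 2` as a function of `t * η ^ (1 + α)`. -/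
noncomputable def secondFun (α θ : ℝ) : ℝ :=
  1 - 4 * Real.exp θ + 6 * Real.exp (2 ^ (1 + α) * θ) - 4 * Real.exp (3 ^ (1 + α) * θ)
    + Real.exp (4 ^ (1 + α) * θ)

lemma hasDerivAt_exp_const_mul (c : ℝ) :
    HasDerivAt (fun θ : ℝ => Real.exp (c * θ)) c 0 := by
  have := ((hasDerivAt_id (0 : ℝ)).const_mul c).exp
  simpa using this

lemma hasDerivAt_meanFun (α : ℝ) : HasDerivAt (meanFun α) (2 ^ (1 + α) - 2) 0 := by
  have h1 := (hasDerivAt_exp_const_mul 1).const_mul 2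
  have h2 := hasDerivAt_exp_const_mul (2 ^ (1 + α))
  have := (h1.const_sub 1).add h2
  simp only [one_mul] at this
  rw [show (2 : ℝ) ^ (1 + α) - 2 = -(2 * 1) + 2 ^ (1 + α) by ring]
  exact this

/-- The value of the derivative is irrelevant: it only enters as the constant in the variance bound.
-/
lemma exists_hasDerivAt_secondFun (α : ℝ) : ∃ c, HasDerivAt (secondFun α) c 0 := by
  have : DifferentiableAt ℝ (secondFun α) 0 := by unfold secondFun; fun_prop
  exact ⟨_, this.hasDerivAt⟩

variable {Ω : Type*} [MeasurableSpace Ω] {P : Measure Ω} {α : ℝ} {X : ℝ≥0 → Ω → ℝ}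

lemma IsSpectrallyPositiveStable.integral_exp (hX : IsSpectrallyPositiveStable P α X) (t : ℝ≥0)
    {η : ℝ} (hη : 0 ≤ η) :
    ∫ ω, Real.exp (-(η * X t ω)) ∂P = Real.exp (t * η ^ (1 + α)) := by
  simpa [mgf] using hX.laplace t η hη

/-- The Bochner integral of a non-integrable function is `0`, so a positive Laplace transform forces
integrability. -/
lemma IsSpectrallyPositiveStable.integrable_exp (hX : IsSpectrallyPositiveStable P α X) (t : ℝ≥0)
    {η : ℝ} (hη : 0 ≤ η) : Integrable (fun ω => Real.exp (-(η * X t ω))) P := by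
  by_contra h
  have := hX.integral_exp t hη
  rw [integral_undef h] at this
  exact (Real.exp_pos _).ne this

lemma IsSpectrallyPositiveStable.integrable_expSq [IsProbabilityMeasure P]
    (hX : IsSpectrallyPositiveStable P α X) (t : ℝ≥0) {η : ℝ} (hη : 0 ≤ η) :
    Integrable (fun ω => expSq (η * X t ω)) P ∧
      ∫ ω, expSq (η * X t ω) ∂P = meanFun α (t * η ^ (1 + α)) := by
  have e : (fun ω => expSq (η * X t ω)) = fun ω => 1 - 2 * Real.exp (-(η * X t ω))
      + Real.exp (-((2 * η) * X t ω)) := by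
    ext ω
    have : Real.exp (-((2 * η) * X t ω)) = Real.exp (-(η * X t ω)) ^ 2 := by
      rw [← Real.exp_nat_mul]; congr 1; push_cast; ring
    rw [this, expSq]; ring
  have i1 := hX.integrable_exp t hη
  have i2 := hX.integrable_exp t (η := 2 * η) (by positivity)
  have i3 : Integrable (fun ω => 1 - 2 * Real.exp (-(η * X t ω))) P :=
    (integrable_const _).sub (i1.const_mul 2)
  rw [e]
  refine ⟨i3.add i2, ?_⟩
  rw [integral_add i3 i2, integral_sub (integrable_const _) (i1.const_mul 2), integral_const_mul,
    hX.integral_exp t hη, hX.integral_exp t (by positivity), Real.mul_rpow (by norm_num) hη]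
  simp only [integral_const, probReal_univ, smul_eq_mul, mul_one, meanFun, mul_left_comm]

lemma IsSpectrallyPositiveStable.integrable_expSq_sq [IsProbabilityMeasure P]
    (hX : IsSpectrallyPositiveStable P α X) (t : ℝ≥0) {η : ℝ} (hη : 0 ≤ η) :
    Integrable (fun ω => expSq (η * X t ω) ^ 2) P ∧
      ∫ ω, expSq (η * X t ω) ^ 2 ∂P = secondFun α (t * η ^ (1 + α)) := by
  have e : (fun ω => expSq (η * X t ω) ^ 2) = fun ω => 1 - 4 * Real.exp (-(η * X t ω))
      + 6 * Real.exp (-((2 * η) * X t ω)) - 4 * Real.exp (-((3 * η) * X t ω))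
      + Real.exp (-((4 * η) * X t ω)) := by
    ext ω
    have h (k : ℕ) : Real.exp (-((k * η) * X t ω)) = Real.exp (-(η * X t ω)) ^ k := by
      rw [← Real.exp_nat_mul]; congr 1; ring
    have h2 := h 2
    have h3 := h 3
    have h4 := h 4
    push_cast at h2 h3 h4
    rw [h2, h3, h4, expSq]; ring
  have i1 := hX.integrable_exp t hη
  have i2 := hX.integrable_exp t (η := 2 * η) (by positivity)
  have i3 := hX.integrable_exp t (η := 3 * η) (by positivity)
  have i4 := hX.integrable_exp t (η := 4 * η) (by positivity)
  have j1 : Integrable (fun ω => 1 - 4 * Real.exp (-(η * X t ω))) P :=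
    (integrable_const _).sub (i1.const_mul 4)
  have j2 : Integrable (fun ω => 1 - 4 * Real.exp (-(η * X t ω))
      + 6 * Real.exp (-((2 * η) * X t ω))) P := j1.add (i2.const_mul 6)
  have j3 : Integrable (fun ω => 1 - 4 * Real.exp (-(η * X t ω))
      + 6 * Real.exp (-((2 * η) * X t ω)) - 4 * Real.exp (-((3 * η) * X t ω))) P :=
    j2.sub (i3.const_mul 4)
  rw [e]
  refine ⟨j3.add i4, ?_⟩
  rw [integral_add j3 i4, integral_sub j2 (i3.const_mul 4), integral_add j1 (i2.const_mul 6),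
    integral_sub (integrable_const _) (i1.const_mul 4)]
  simp only [integral_const_mul]
  rw [hX.integral_exp t hη, hX.integral_exp t (by positivity), hX.integral_exp t (by positivity),
    hX.integral_exp t (by positivity), Real.mul_rpow (by norm_num) hη,
    Real.mul_rpow (by norm_num) hη, Real.mul_rpow (by norm_num) hη]
  simp only [integral_const, probReal_univ, smul_eq_mul, mul_one, secondFun, mul_left_comm]

/-! ### Sums over uniform partitions -/

/-- The `i`-th point of the uniform partition of `[0, T]` into `n + 1` intervals. -/
noncomputable def gridPoint (T : ℝ≥0) (n i : ℕ) : ℝ≥0 := i * (T / (n + 1))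

lemma gridPoint_succ (T : ℝ≥0) (n i : ℕ) :
    gridPoint T n (i + 1) = gridPoint T n i + T / (n + 1) := by
  simp [gridPoint, add_mul]

lemma monotone_gridPoint (T : ℝ≥0) (n : ℕ) : Monotone (gridPoint T n) := fun i j h => by
  unfold gridPoint; gcongr

lemma gridPoint_zero (T : ℝ≥0) (n : ℕ) : gridPoint T n 0 = 0 := by simp [gridPoint]

lemma gridPoint_last (T : ℝ≥0) (n : ℕ) : gridPoint T n (n + 1) = T := by
  unfold gridPoint; push_cast; field_simp

/-- The sum of `expSq (η * ·)` over the increments of `f` along a uniform partition of `[0, T]`. -/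
noncomputable def gridSum (f : ℝ≥0 → ℝ) (T : ℝ≥0) (η : ℝ) (n : ℕ) : ℝ :=
  ∑ i ∈ Finset.range (n + 1), expSq (η * (f (gridPoint T n (i + 1)) - f (gridPoint T n i)))

lemma gridSum_nonneg (f : ℝ≥0 → ℝ) (T : ℝ≥0) (η : ℝ) (n : ℕ) : 0 ≤ gridSum f T η n :=
  Finset.sum_nonneg fun _ _ => expSq_nonneg _

lemma IsSpectrallyPositiveStable.measurable_gridSum (hX : IsSpectrallyPositiveStable P α X)
    (T : ℝ≥0) (η : ℝ) (n : ℕ) : Measurable (fun ω => gridSum (X · ω) T η n) := by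
  unfold gridSum
  refine Finset.measurable_sum _ fun i _ => continuous_expSq.measurable.comp ?_
  exact ((hX.levy.measurable _).sub (hX.levy.measurable _)).const_mul η

lemma IsSpectrallyPositiveStable.identDistrib_expSq (hX : IsSpectrallyPositiveStable P α X)
    (T : ℝ≥0) (η : ℝ) (n i : ℕ) :
    IdentDistrib (fun ω => expSq (η * (X (gridPoint T n (i + 1)) ω - X (gridPoint T n i) ω)))
      (fun ω => expSq (η * X (T / (n + 1)) ω)) P P := by
  have h := hX.levy.stationary (gridPoint T n i) (T / (n + 1))
  rw [← gridPoint_succ] at h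
  exact h.comp (u := fun x => expSq (η * x))
    (continuous_expSq.measurable.comp (measurable_const_mul η))

lemma IsSpectrallyPositiveStable.integrable_gridSum [IsProbabilityMeasure P]
    (hX : IsSpectrallyPositiveStable P α X) (T : ℝ≥0) {η : ℝ} (hη : 0 ≤ η) (n : ℕ) :
    Integrable (fun ω => gridSum (X · ω) T η n) P :=
  integrable_finsetSum _ fun i _ =>
    (hX.identDistrib_expSq T η n i).integrable_iff.2 (hX.integrable_expSq _ hη).1

lemma IsSpectrallyPositiveStable.integral_gridSum [IsProbabilityMeasure P]
    (hX : IsSpectrallyPositiveStable P α X) (T : ℝ≥0) {η : ℝ} (hη : 0 ≤ η) (n : ℕ) :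
    ∫ ω, gridSum (X · ω) T η n ∂P = (n + 1) * meanFun α (T * η ^ (1 + α) / (n + 1)) := by
  unfold gridSum
  rw [integral_finsetSum _ fun i _ =>
    (hX.identDistrib_expSq T η n i).integrable_iff.2 (hX.integrable_expSq _ hη).1]
  simp_rw [fun i => (hX.identDistrib_expSq T η n i).integral_eq, (hX.integrable_expSq _ hη).2]
  simp only [Finset.sum_const, Finset.card_range, nsmul_eq_mul]
  push_cast
  ring_nf

lemma IsSpectrallyPositiveStable.tendsto_integral_gridSum [IsProbabilityMeasure P]
    (hX : IsSpectrallyPositiveStable P α X) (T : ℝ≥0) {η : ℝ} (hη : 0 ≤ η) :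
    Tendsto (fun n => ∫ ω, gridSum (X · ω) T η n ∂P) atTop
      (𝓝 (T * η ^ (1 + α) * (2 ^ (1 + α) - 2))) := by
  simp_rw [hX.integral_gridSum T hη]
  exact tendsto_mul_comp_div (hasDerivAt_meanFun α) (by norm_num [meanFun]) _

lemma IsSpectrallyPositiveStable.memLp_expSq [IsProbabilityMeasure P]
    (hX : IsSpectrallyPositiveStable P α X) (T : ℝ≥0) {η : ℝ} (hη : 0 ≤ η) (n i : ℕ) :
    MemLp (fun ω => expSq (η * (X (gridPoint T n (i + 1)) ω - X (gridPoint T n i) ω))) 2 P := by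
  rw [(hX.identDistrib_expSq T η n i).memLp_iff, memLp_two_iff_integrable_sq]
  · exact (hX.integrable_expSq_sq _ hη).1
  · exact (hX.integrable_expSq _ hη).1.aestronglyMeasurable

lemma IsSpectrallyPositiveStable.memLp_gridSum [IsProbabilityMeasure P]
    (hX : IsSpectrallyPositiveStable P α X) (T : ℝ≥0) {η : ℝ} (hη : 0 ≤ η) (n : ℕ) :
    MemLp (fun ω => gridSum (X · ω) T η n) 2 P :=
  memLp_finsetSum _ fun i _ => hX.memLp_expSq T hη n i

/-- Independent increments make the variance additive, and each variance is at most a second moment.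
-/
lemma IsSpectrallyPositiveStable.variance_gridSum_le [IsProbabilityMeasure P]
    (hX : IsSpectrallyPositiveStable P α X) (T : ℝ≥0) {η : ℝ} (hη : 0 ≤ η) (n : ℕ) :
    Var[fun ω => gridSum (X · ω) T η n; P]
      ≤ (n + 1) * secondFun α (T * η ^ (1 + α) / (n + 1)) := by
  have hind := (hX.levy.indep.nat (monotone_gridPoint T n)).comp (fun _ x => expSq (η * x))
    fun _ => continuous_expSq.measurable.comp (measurable_const_mul η)
  have e : (fun ω => gridSum (X · ω) T η n) = ∑ i ∈ Finset.range (n + 1),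
      fun ω => expSq (η * (X (gridPoint T n (i + 1)) ω - X (gridPoint T n i) ω)) := by
    ext ω; simp [gridSum]
  rw [e, IndepFun.variance_sum (fun i _ => hX.memLp_expSq T hη n i)
    (fun i _ j _ hij => hind.indepFun hij)]
  calc _ ≤ ∑ i ∈ Finset.range (n + 1), secondFun α ((T / (n + 1) : ℝ≥0) * η ^ (1 + α)) := by
        refine Finset.sum_le_sum fun i _ => ?_
        rw [(hX.identDistrib_expSq T η n i).variance_eq, ← (hX.integrable_expSq_sq _ hη).2]
        exact variance_le_expectation_sq (hX.integrable_expSq _ hη).1.aestronglyMeasurable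
    _ = _ := by
        simp only [Finset.sum_const, Finset.card_range, nsmul_eq_mul]
        push_cast
        ring_nf

/-! ### Càdlàg paths along uniform partitions -/

lemma IsCadlag.tendsto_leftLim {f : ℝ≥0 → ℝ} (hf : IsCadlag f) (t : ℝ≥0) :
    Tendsto f (𝓝[<] t) (𝓝 (Function.leftLim f t)) := by
  rcases eq_or_neBot (𝓝[<] t) with h | h
  · rw [h]; exact tendsto_bot
  · obtain ⟨l, hl⟩ := (hf t).2
    rwa [leftLim_eq_of_tendsto hl]

/-- No time precedes `0`, and there `leftLim` defaults to the value of the function. -/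
lemma jump_zero (f : ℝ≥0 → ℝ) : jump f 0 = 0 := by
  have : 𝓝[<] (0 : ℝ≥0) = ⊥ := by
    have : Iio (0 : ℝ≥0) = ∅ := by ext; simp
    rw [this, nhdsWithin_empty]
  rw [jump, leftLim_eq_of_eq_bot f this, sub_self]

lemma exists_gridPoint_lt_le {T t : ℝ≥0} (ht : 0 < t) (htT : t ≤ T) (n : ℕ) :
    ∃ i < n + 1, gridPoint T n i < t ∧ t ≤ gridPoint T n (i + 1) := by
  classical
  have hex : ∃ i, t ≤ gridPoint T n i := ⟨n + 1, by rwa [gridPoint_last]⟩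
  have h0 : Nat.find hex ≠ 0 := fun h => by
    have := Nat.find_spec hex
    rw [h, gridPoint_zero] at this
    exact this.not_gt ht
  obtain ⟨i, hi⟩ := Nat.exists_eq_succ_of_ne_zero h0
  have hle : Nat.find hex ≤ n + 1 := Nat.find_min' hex (by rwa [gridPoint_last])
  refine ⟨i, by omega, ?_, ?_⟩
  · exact not_le.1 (Nat.find_min hex (m := i) (by omega))
  · have := Nat.find_spec hex
    rwa [hi] at this

lemma tendsto_div_add_one (T : ℝ≥0) : Tendsto (fun n : ℕ => T / ((n : ℝ≥0) + 1)) atTop (𝓝 0) := by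
  rw [← NNReal.tendsto_coe]
  have := (tendsto_one_div_add_atTop_nhds_zero_nat (𝕜 := ℝ)).const_mul (T : ℝ)
  simpa [div_eq_mul_inv] using this

/-- On fine partitions the chosen times lie in distinct cells, and the increment over the cell of
`t` tends to the jump at `t`. Cells are open on the left and closed on the right, so left endpoints
approach `t` strictly from below and produce the left limit. -/
lemma sum_expSq_jump_le_liminf {f : ℝ≥0 → ℝ} (hf : IsCadlag f) (T : ℝ≥0) (s : Finset ℝ≥0)
    (hs : ∀ t ∈ s, 0 < t ∧ t ≤ T) :
    ∑ t ∈ s, ENNReal.ofReal (expSq (jump f t)) ≤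
      liminf (fun n => ENNReal.ofReal (gridSum f T 1 n)) atTop := by
  classical
  have hex : ∀ n t, ∃ i, t ∈ s →
      i < n + 1 ∧ gridPoint T n i < t ∧ t ≤ gridPoint T n (i + 1) := fun n t => by
    by_cases h : t ∈ s
    · obtain ⟨i, hi⟩ := exists_gridPoint_lt_le (hs t h).1 (hs t h).2 n
      exact ⟨i, fun _ => hi⟩
    · exact ⟨0, fun h' => absurd h' h⟩
  choose idx hidx using hex
  have hT := tendsto_div_add_one T
  have hleft : ∀ t ∈ s, Tendsto (fun n => gridPoint T n (idx n t)) atTop (𝓝 t) := fun t ht => by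
    refine tendsto_of_tendsto_of_tendsto_of_le_of_le (g := fun n : ℕ => t - T / ((n : ℝ≥0) + 1))
      (by simpa using tendsto_const_nhds.sub hT) tendsto_const_nhds (fun n => ?_)
      (fun n => (hidx n t ht).2.1.le)
    have := (hidx n t ht).2.2
    rw [gridPoint_succ] at this
    exact tsub_le_iff_right.2 this
  have hright : ∀ t ∈ s, Tendsto (fun n => gridPoint T n (idx n t + 1)) atTop (𝓝 t) :=
    fun t ht => by
      have := (hleft t ht).add hT
      simpa only [add_zero, ← gridPoint_succ] using this
  have hlim : ∀ t ∈ s, Tendsto (fun n => expSq (1 * (f (gridPoint T n (idx n t + 1)) -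
      f (gridPoint T n (idx n t))))) atTop (𝓝 (expSq (jump f t))) := fun t ht => by
    have h1 : Tendsto (fun n => f (gridPoint T n (idx n t))) atTop
        (𝓝 (Function.leftLim f t)) :=
      (hf.tendsto_leftLim t).comp (tendsto_nhdsWithin_iff.2
        ⟨hleft t ht, Eventually.of_forall fun n => (hidx n t ht).2.1⟩)
    have h2 : Tendsto (fun n => f (gridPoint T n (idx n t + 1))) atTop (𝓝 (f t)) :=
      (hf t).1.tendsto.comp (tendsto_nhdsWithin_iff.2
        ⟨hright t ht, Eventually.of_forall fun n => (hidx n t ht).2.2⟩)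
    simp only [one_mul]
    exact (continuous_expSq.tendsto _).comp (h2.sub h1)
  have hinj : ∀ᶠ n in atTop, ∀ t ∈ s, ∀ t' ∈ s, t < t' →
      gridPoint T n (idx n t) < gridPoint T n (idx n t') := by
    rw [Finset.eventually_all]
    intro t ht
    rw [Finset.eventually_all]
    intro t' ht'
    by_cases h : t < t'
    · filter_upwards [(hleft t ht).eventually_lt (hleft t' ht') h] with n hn _ using hn
    · exact Eventually.of_forall fun n h' => absurd h' h
  have hle : ∀ᶠ n in atTop, ∑ t ∈ s, expSq (1 * (f (gridPoint T n (idx n t + 1)) -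
      f (gridPoint T n (idx n t)))) ≤ gridSum f T 1 n := by
    filter_upwards [hinj] with n hn
    have hio : InjOn (idx n) s := fun t ht t' ht' h => by
      rcases lt_trichotomy t t' with hlt | rfl | hlt
      · have := hn t ht t' ht' hlt
        rw [h] at this
        exact absurd this (lt_irrefl _)
      · rfl
      · have := hn t' ht' t ht hlt
        rw [h] at this
        exact absurd this (lt_irrefl _)
    rw [← Finset.sum_image (f := fun i => expSq (1 * (f (gridPoint T n (i + 1)) -
      f (gridPoint T n i)))) hio]
    refine Finset.sum_le_sum_of_subset_of_nonneg ?_ fun _ _ _ => expSq_nonneg _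
    intro i hi
    obtain ⟨t, ht, rfl⟩ := Finset.mem_image.1 hi
    exact Finset.mem_range.2 (hidx n t ht).1
  rw [← ENNReal.ofReal_sum_of_nonneg fun _ _ => expSq_nonneg _]
  have hlim' := ENNReal.tendsto_ofReal (tendsto_finsetSum s hlim)
  rw [← hlim'.liminf_eq]
  exact liminf_le_liminf (hle.mono fun n hn => ENNReal.ofReal_le_ofReal hn)

lemma tsum_expSq_jump_le_liminf {f : ℝ≥0 → ℝ} (hf : IsCadlag f) (T : ℝ≥0) :
    ∑' t : Iic T, ENNReal.ofReal (expSq (jump f t)) ≤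
      liminf (fun n => ENNReal.ofReal (gridSum f T 1 n)) atTop := by
  classical
  rw [ENNReal.tsum_eq_iSup_sum]
  refine iSup_le fun s => ?_
  -- Time `0` lies in no cell; it is discarded because it carries no jump.
  refine le_trans ?_ (sum_expSq_jump_le_liminf hf T ((s.map (Function.Embedding.subtype _)).filter
    (0 < ·)) fun t ht => ?_)
  · rw [Finset.sum_filter_of_ne, Finset.sum_map]
    · rfl
    · intro t _ h
      by_contra h0
      obtain rfl : t = 0 := by simpa using h0
      simp [jump_zero, expSq] at h
  · simp only [Finset.mem_filter, Finset.mem_map, Function.Embedding.subtype_apply] at ht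
    obtain ⟨⟨x, _, rfl⟩, h0⟩ := ht
    exact ⟨h0, x.2⟩

/-- The sum of the jumps of a path, as a measure on the time axis. -/
noncomputable def jumpMeasure (f : ℝ≥0 → ℝ) : Measure ℝ≥0 :=
  Measure.sum fun s => ENNReal.ofReal (jump f s) • Measure.dirac s

lemma jumpMeasure_apply (f : ℝ≥0 → ℝ) {A : Set ℝ≥0} (hA : MeasurableSet A) :
    jumpMeasure f A = ∑' t : A, ENNReal.ofReal (jump f t) := by
  rw [jumpMeasure, Measure.sum_apply _ hA, tsum_subtype A fun t => ENNReal.ofReal (jump f t)]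
  refine tsum_congr fun t => ?_
  by_cases h : t ∈ A <;> simp [hA, h]

/-- Near `t` the path stays within `ε / 2` of its left limit before `t` and of its value from `t`
on, so only the jump at `t` itself can make an increment large. -/
lemma IsCadlag.eventually_increment_le {f : ℝ≥0 → ℝ} (hf : IsCadlag f)
    (hpos : ∀ t, 0 ≤ jump f t) {ε : ℝ} (hε : 0 < ε) (t : ℝ≥0) :
    ∃ U, IsOpen U ∧ t ∈ U ∧ ∀ u ∈ U, ∀ v ∈ U, u ≤ v →
      -ε ≤ f v - f u ∧ (f v - f u ≤ ε ∨ (t ∈ Ioc u v ∧ f v - f u ≤ ε + jump f t)) := by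
  have h1 : ∀ᶠ x in 𝓝 t, x ∈ Iio t → |f x - Function.leftLim f t| < ε / 2 := by
    rw [← eventually_nhdsWithin_iff]
    have := (hf.tendsto_leftLim t).eventually (Metric.ball_mem_nhds _ (half_pos hε))
    simpa [Real.dist_eq] using this
  have h2 : ∀ᶠ x in 𝓝 t, x ∈ Ici t → |f x - f t| < ε / 2 := by
    rw [← eventually_nhdsWithin_iff]
    have := (hf t).1.tendsto.eventually (Metric.ball_mem_nhds _ (half_pos hε))
    simpa [Real.dist_eq] using this
  obtain ⟨U, hU, hUo, htU⟩ := eventually_nhds_iff.1 (h1.and h2)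
  refine ⟨U, hUo, htU, fun u hu v hv huv => ?_⟩
  have hj := hpos t
  rcases lt_or_ge v t with h | h
  · have a1 := abs_lt.1 ((hU u hu).1 (huv.trans_lt h))
    have a2 := abs_lt.1 ((hU v hv).1 h)
    exact ⟨by linarith [a1.2, a2.1], Or.inl (by linarith [a1.1, a2.2])⟩
  · have a2 := abs_lt.1 ((hU v hv).2 h)
    rcases lt_or_ge u t with h' | h'
    · have a1 := abs_lt.1 ((hU u hu).1 h')
      unfold jump at hj ⊢
      exact ⟨by linarith [a1.2, a2.1], Or.inr ⟨⟨h', h⟩, by linarith [a1.1, a2.2]⟩⟩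
    · have a1 := abs_lt.1 ((hU u hu).2 h')
      exact ⟨by linarith [a1.2, a2.1], Or.inl (by linarith [a1.1, a2.2])⟩

/-- A Lebesgue number of the cover of `[0, T]` by these neighbourhoods makes the local estimate
uniform. -/
lemma IsCadlag.exists_increment_le {f : ℝ≥0 → ℝ} (hf : IsCadlag f) (hpos : ∀ t, 0 ≤ jump f t)
    {T : ℝ≥0} (hT : jumpMeasure f (Iic T) ≠ ∞) {ε : ℝ} (hε : 0 < ε) :
    ∃ δ > 0, ∀ u v, u ≤ v → v ≤ T → dist v u < δ →
      -ε ≤ f v - f u ∧ f v - f u ≤ ε + (jumpMeasure f).real (Ioc u v) := by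
  choose U hUo htU hU using hf.eventually_increment_le hpos hε
  obtain ⟨δ, hδ, hball⟩ := lebesgue_number_lemma_of_metric (isCompact_Icc (a := (0 : ℝ≥0)) (b := T))
    hUo (fun t _ => mem_iUnion.2 ⟨t, htU t⟩)
  refine ⟨δ, hδ, fun u v huv hv hd => ?_⟩
  obtain ⟨t, ht⟩ := hball u ⟨zero_le, huv.trans hv⟩
  obtain ⟨h1, h2⟩ := hU t u (ht (Metric.mem_ball_self hδ)) v (ht hd) huv
  refine ⟨h1, ?_⟩
  rcases h2 with h2 | ⟨htuv, h2⟩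
  · have : 0 ≤ (jumpMeasure f).real (Ioc u v) := measureReal_nonneg
    linarith
  · refine h2.trans ?_
    gcongr
    have hne : jumpMeasure f (Ioc u v) ≠ ∞ :=
      ne_top_of_le_ne_top hT (measure_mono fun x hx => hx.2.trans hv)
    rw [← ENNReal.ofReal_le_ofReal_iff measureReal_nonneg, ofReal_measureReal hne,
      jumpMeasure_apply f measurableSet_Ioc]
    exact ENNReal.le_tsum (f := fun t : Ioc u v => ENNReal.ofReal (jump f t)) ⟨t, htuv⟩

lemma sum_jumpMeasure_gridPoint_le {f : ℝ≥0 → ℝ} {T : ℝ≥0} (hT : jumpMeasure f (Iic T) ≠ ∞)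
    (n : ℕ) :
    ∑ i ∈ Finset.range (n + 1), (jumpMeasure f).real (Ioc (gridPoint T n i) (gridPoint T n (i + 1)))
      ≤ (jumpMeasure f).real (Iic T) := by
  have hd : Pairwise (Function.onFun Disjoint
      fun i => Ioc (gridPoint T n i) (gridPoint T n (i + 1))) :=
    (monotone_gridPoint T n).pairwise_disjoint_on_Ioc_succ
  have hsub : ∀ i ∈ Finset.range (n + 1),
      Ioc (gridPoint T n i) (gridPoint T n (i + 1)) ⊆ Iic T := fun i hi x hx => by
    rw [← gridPoint_last T n]
    exact hx.2.trans (monotone_gridPoint T n (Finset.mem_range.1 hi))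
  rw [← measureReal_biUnion_finset (fun i _ j _ hij => hd hij) (fun _ _ => measurableSet_Ioc)
    fun i hi => ne_top_of_le_ne_top hT (measure_mono (hsub i hi))]
  exact measureReal_mono (iUnion₂_subset hsub) hT

lemma IsCadlag.eventually_gridSum_le {f : ℝ≥0 → ℝ} (hf : IsCadlag f) (hpos : ∀ t, 0 ≤ jump f t)
    {T : ℝ≥0} (hT : jumpMeasure f (Iic T) ≠ ∞) {η ε : ℝ} (hη : 0 < η) (hε : 0 < ε)
    (hηε : η * ε ≤ 1) :
    ∀ᶠ n in atTop, gridSum f T η n ≤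
      64 * η * (jumpMeasure f).real (Iic T) + 576 * (η * ε) ^ 2 * gridSum f T ε⁻¹ n := by
  obtain ⟨δ, hδ, h⟩ := hf.exists_increment_le hpos hT hε
  have hmesh := NNReal.tendsto_coe.2 (tendsto_div_add_one T)
  filter_upwards [hmesh.eventually_lt_const (u := δ) (by simpa using hδ)] with n hn
  calc gridSum f T η n
      ≤ ∑ i ∈ Finset.range (n + 1), (64 * η *
          (jumpMeasure f).real (Ioc (gridPoint T n i) (gridPoint T n (i + 1))) +
          576 * (η * ε) ^ 2 * expSq (ε⁻¹ * (f (gridPoint T n (i + 1)) - f (gridPoint T n i)))) := by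
        refine Finset.sum_le_sum fun i hi => ?_
        have hle := monotone_gridPoint T n (Nat.le_succ i)
        obtain ⟨h1, h2⟩ := h _ _ hle (by
          have := monotone_gridPoint T n (Finset.mem_range.1 hi)
          rwa [gridPoint_last] at this) (by
          rw [Nat.succ_eq_add_one, gridPoint_succ, NNReal.dist_eq]
          push_cast at hn ⊢
          rw [add_sub_cancel_left, abs_of_nonneg (by positivity)]
          exact hn)
        have := expSq_mul_le hη hε hηε h1 h2 measureReal_nonneg
        rwa [div_eq_inv_mul] at this
    _ = 64 * η * ∑ i ∈ Finset.range (n + 1),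
          (jumpMeasure f).real (Ioc (gridPoint T n i) (gridPoint T n (i + 1))) +
          576 * (η * ε) ^ 2 * gridSum f T ε⁻¹ n := by
        rw [Finset.sum_add_distrib, ← Finset.mul_sum, ← Finset.mul_sum]; rfl
    _ ≤ _ := by
        gcongr
        exact sum_jumpMeasure_gridPoint_le hT n

/-! ### Hölder constants of the marks -/

/-- The paths whose `γ`-Hölder constant on the nonnegative half-line exceeds `k`. -/
def exceedSet (γ k : ℝ) : Set MarkPath :=
  {f | ∃ r s : ℚ, (0 : ℝ) ≤ r ∧ (r : ℝ) < s ∧ k * |(s : ℝ) - r| ^ γ < |f.1 s - f.1 r|}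

lemma measurable_eval_markPath (s : ℝ) : Measurable fun f : MarkPath => f.1 s :=
  (measurable_pi_apply s).comp measurable_subtype_coe

lemma measurableSet_exceedSet (γ k : ℝ) : MeasurableSet (exceedSet γ k) := by
  have : exceedSet γ k = ⋃ (r : ℚ) (s : ℚ), {f : MarkPath | (0 : ℝ) ≤ r ∧ (r : ℝ) < s ∧
      k * |(s : ℝ) - r| ^ γ < |f.1 s - f.1 r|} := by
    ext f; simp [exceedSet]
  rw [this]
  refine MeasurableSet.iUnion fun r => MeasurableSet.iUnion fun s => ?_
  refine (MeasurableSet.const _).inter ((MeasurableSet.const _).inter ?_)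
  exact measurableSet_lt measurable_const
    ((measurable_eval_markPath s).sub (measurable_eval_markPath r)).abs

/-- A violation at real times is an open condition by continuity, so it persists at nearby rational
times, chosen to the right of `r` and `s` to stay nonnegative and ordered. -/
lemma holderConst_le_of_notMem_exceedSet {γ k : ℝ} (hγ : 0 < γ) {f : MarkPath}
    (hf : f ∉ exceedSet γ k) (x : ℝ) : holderConst γ x f.1 ≤ ENNReal.ofReal k := by
  refine iSup_le fun r => iSup_le fun s => iSup_le fun ⟨hr, hrs, _⟩ => ?_
  refine ENNReal.ofReal_le_ofReal ?_
  rw [div_le_iff₀ (Real.rpow_pos_of_pos (abs_pos.2 (sub_ne_zero.2 hrs.ne')) _)]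
  by_contra! h
  have hc1 : Continuous fun p : ℝ × ℝ => k * |p.2 - p.1| ^ γ :=
    continuous_const.mul (((continuous_snd.sub continuous_fst).abs).rpow_const
      fun _ => Or.inr hγ.le)
  have hc2 : Continuous fun p : ℝ × ℝ => |f.1 p.2 - f.1 p.1| :=
    ((f.2.1.comp continuous_snd).sub (f.2.1.comp continuous_fst)).abs
  have hev := (isOpen_lt hc1 hc2).mem_nhds (x := (r, s)) h
  obtain ⟨δ, hδ, hball⟩ := Metric.mem_nhds_iff.1 hev
  obtain ⟨r', hr1, hr2⟩ := exists_rat_btwn (lt_min hrs (lt_add_of_pos_right r hδ))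
  obtain ⟨s', hs1, hs2⟩ := exists_rat_btwn (lt_add_of_pos_right s hδ)
  rw [lt_min_iff] at hr2
  refine hf ⟨r', s', hr.trans hr1.le, hr2.1.trans hs1, hball (a := ((r' : ℝ), (s' : ℝ))) ?_⟩
  rw [Metric.mem_ball, Prod.dist_eq, max_lt_iff, Real.dist_eq, Real.dist_eq, abs_lt, abs_lt]
  refine ⟨⟨?_, ?_⟩, ?_, ?_⟩ <;> simp only <;> linarith

lemma le_holderConst_of_scalePath_mem {q γ k : ℝ} (hγ : 0 < γ) (hk : 0 ≤ k) {x : ℝ≥0}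
    (hx : 0 < x) {f : MarkPath} (hf : ∀ s, s ∉ Ioo (0 : ℝ) 1 → f.1 s = 0)
    (hmem : scalePath q x f ∈ exceedSet γ k) :
    ENNReal.ofReal (k * (x : ℝ) ^ (γ - q)) ≤ holderConst γ 1 f.1 := by
  obtain ⟨r, s, hr, hrs, h⟩ := hmem
  have hx' : (0 : ℝ) < x := hx
  -- The rational times may exceed `x`. Since the path vanishes from `1` on, rescaled times can be
  -- clipped to `[0, 1]`: values are unchanged and the gap can only shrink.
  have hclip : ∀ u : ℝ, f.1 (min u 1) = f.1 u := fun u => by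
    rcases le_total u 1 with h | h
    · rw [min_eq_left h]
    · rw [min_eq_right h, hf u fun h' => h'.2.not_ge h, hf 1 (by simp)]
  have hsr : (0 : ℝ) < (s : ℝ) - r := sub_pos.2 hrs
  have h' : k * ((s : ℝ) - r) ^ γ <
      (x : ℝ) ^ q * |f.1 (min (s / x) 1) - f.1 (min (r / x) 1)| := by
    rw [hclip, hclip]
    simpa [scalePath, ← mul_sub, abs_mul, abs_of_pos (Real.rpow_pos_of_pos hx' q),
      abs_of_pos hsr] using h
  have hdiv : (r : ℝ) / x < s / x := by gcongr
  have hle : min ((r : ℝ) / x) 1 ≤ min ((s : ℝ) / x) 1 := min_le_min_right _ hdiv.le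
  have hlt : min ((r : ℝ) / x) 1 < min ((s : ℝ) / x) 1 := by
    refine lt_of_le_of_ne hle fun heq => ?_
    rw [heq] at h'
    have : 0 ≤ k * ((s : ℝ) - r) ^ γ := by positivity
    simp at h'
    linarith
  set s' := min ((s : ℝ) / x) 1
  set r' := min ((r : ℝ) / x) 1
  have hd : s' - r' ≤ ((s : ℝ) - r) / x := by
    rw [sub_div]
    rcases le_total ((s : ℝ) / x) 1 with h1 | h1
    · have e1 : s' = (s : ℝ) / x := min_eq_left h1
      have e2 : r' = (r : ℝ) / x := min_eq_left (hdiv.le.trans h1)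
      rw [e1, e2]
    · have e1 : s' = 1 := min_eq_right h1
      rcases le_total ((r : ℝ) / x) 1 with h2 | h2
      · have e2 : r' = (r : ℝ) / x := min_eq_left h2
        linarith
      · have e2 : r' = 1 := min_eq_right h2
        linarith
  have hr' : 0 ≤ r' := le_min (by positivity) zero_le_one
  refine le_trans (ENNReal.ofReal_le_ofReal ?_)
    (le_iSup₂_of_le r' s' (le_iSup_of_le ⟨hr', hlt, min_le_right _ _⟩ le_rfl))
  have hpos : 0 < s' - r' := sub_pos.2 hlt
  rw [abs_of_pos hpos, le_div_iff₀ (Real.rpow_pos_of_pos hpos _)]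
  have hxq := Real.rpow_pos_of_pos hx' q
  have hxγ := Real.rpow_pos_of_pos hx' γ
  calc k * (x : ℝ) ^ (γ - q) * (s' - r') ^ γ
      ≤ k * (x : ℝ) ^ (γ - q) * (((s : ℝ) - r) / x) ^ γ := by gcongr
    _ = k * ((s : ℝ) - r) ^ γ / (x : ℝ) ^ q := by
        rw [Real.rpow_sub hx', Real.div_rpow hsr.le hx'.le]; field_simp
    _ ≤ |f.1 s' - f.1 r'| := by
        rw [div_le_iff₀ hxq]; linarith

lemma measurable_scalePath (q : ℝ) (x : ℝ≥0) : Measurable (scalePath q x) := by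
  refine Measurable.subtype_mk (measurable_pi_lambda _ fun s => ?_)
  exact (measurable_eval_markPath _).const_mul _

variable {q γ : ℝ} {κ : Kernel ℝ≥0 MarkPath}

lemma IsSelfSimilarMarking.exceedSet_zero (hκ : IsSelfSimilarMarking q κ) {k : ℝ} (hk : 0 ≤ k) :
    κ 0 (exceedSet γ k) = 0 := by
  refine measure_mono_null ?_ (hκ.supp 0)
  rintro f ⟨r, s, -, hrs, h⟩ hf
  have hf0 : ∀ s, f.1 s = 0 := fun s => hf s (by simp)
  rw [hf0, hf0] at h
  have : 0 ≤ k * |(s : ℝ) - r| ^ γ := by positivity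
  simp at h
  linarith

/-- Markov's inequality after rescaling to `κ 1`, proved by comparison with an indicator so that
measurability of `holderConst` is not needed. -/
lemma IsSelfSimilarMarking.mul_exceedSet_le (hκ : IsSelfSimilarMarking q κ) (hγ : 0 < γ) {k p : ℝ}
    (hk : 0 ≤ k) (hp : 0 < p) {x : ℝ≥0} (hx : 0 < x) :
    ENNReal.ofReal (k * (x : ℝ) ^ (γ - q)) ^ p * κ x (exceedSet γ k) ≤
      ∫⁻ f, holderConst γ 1 f.1 ^ p ∂(κ 1) := by
  have hm : MeasurableSet (scalePath q x ⁻¹' exceedSet γ k) :=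
    measurable_scalePath q x (measurableSet_exceedSet γ k)
  rw [hκ.scaling x hx, Measure.map_apply (measurable_scalePath q x) (measurableSet_exceedSet γ k),
    ← lintegral_indicator_const hm]
  refine lintegral_mono_ae ?_
  filter_upwards [hκ.supp 1] with f hf
  by_cases h : f ∈ scalePath q x ⁻¹' exceedSet γ k
  · rw [indicator_of_mem h]
    gcongr
    exact le_holderConst_of_scalePath_mem hγ hk hx (by simpa using hf) h
  · rw [indicator_of_notMem h]
    exact zero_le

/-- Each single mark has a finite Hölder constant: the first moment bounds `k` times the probability
for every `k`. -/
lemma IsSelfSimilarMarking.iInter_exceedSet (hκ : IsSelfSimilarMarking q κ) (hγ : 0 < γ)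
    (hmom : ∀ p : ℝ, 0 < p → ∫⁻ f, holderConst γ 1 f.1 ^ p ∂(κ 1) < ∞) (x : ℝ≥0) :
    κ x (⋂ k : ℕ, exceedSet γ k) = 0 := by
  rcases eq_or_ne x 0 with rfl | hx
  · exact measure_mono_null (iInter_subset _ 0) (hκ.exceedSet_zero (by simp))
  have hx' : 0 < x := pos_iff_ne_zero.2 hx
  by_contra h
  have hc : ENNReal.ofReal ((x : ℝ) ^ (γ - q)) ≠ 0 := by
    simpa using Real.rpow_pos_of_pos (show (0 : ℝ) < x from hx') _
  obtain ⟨k, hk⟩ := ENNReal.exists_nat_mul_gt (mul_ne_zero hc h) (hmom 1 one_pos).ne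
  refine hk.not_ge (le_trans ?_ (hκ.mul_exceedSet_le hγ k.cast_nonneg one_pos hx'))
  rw [ENNReal.rpow_one, ENNReal.ofReal_mul k.cast_nonneg, ENNReal.ofReal_natCast, ← mul_assoc]
  gcongr
  exact iInter_subset _ k

/-- Large Hölder constants are unlikely for the marks of small jumps. -/
lemma IsSelfSimilarMarking.exists_exceedSet_le [IsMarkovKernel κ] (hκ : IsSelfSimilarMarking q κ)
    (hγ : 0 < γ ∧ γ < q)
    (hmom : ∀ p : ℝ, 0 < p → ∫⁻ f, holderConst γ 1 f.1 ^ p ∂(κ 1) < ∞) :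
    ∃ C : ℝ≥0∞, C ≠ ∞ ∧ ∀ x : ℝ≥0, κ x (exceedSet γ 1) ≤ C * ENNReal.ofReal (expSq x) := by
  have hqγ : 0 < q - γ := sub_pos.2 hγ.2
  -- This order turns `x ^ ((γ - q) * p)` into `x ^ (-2)`, matching the quadratic behaviour of
  -- `expSq` at `0`.
  set p := 2 / (q - γ) with hp
  have hp0 : 0 < p := by positivity
  set M := ∫⁻ f, holderConst γ 1 f.1 ^ p ∂(κ 1)
  have hM : M ≠ ∞ := (hmom p hp0).ne
  -- `M + 1` dominates both the moment `M` (small `x`) and the trivial bound `1` (large `x`); `9`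
  -- comes from `min_one_sq_le_expSq`.
  refine ⟨(M + 1) * ENNReal.ofReal 9, ENNReal.mul_ne_top (by simpa using hM) (by simp),
    fun x => ?_⟩
  rcases eq_or_ne x 0 with rfl | hx
  · rw [hκ.exceedSet_zero zero_le_one]; exact zero_le
  have hx' : (0 : ℝ) < x := NNReal.coe_pos.2 (pos_iff_ne_zero.2 hx)
  have h1 : κ x (exceedSet γ 1) ≤ (M + 1) * ENNReal.ofReal ((x : ℝ) ^ 2) := by
    have h := hκ.mul_exceedSet_le hγ.1 zero_le_one hp0 (pos_iff_ne_zero.2 hx)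
    rw [one_mul, ENNReal.ofReal_rpow_of_pos (Real.rpow_pos_of_pos hx' _), ← Real.rpow_mul hx'.le,
      show (γ - q) * p = -(2 : ℕ) by rw [hp]; push_cast; field_simp; ring,
      Real.rpow_neg hx'.le, Real.rpow_natCast, ENNReal.ofReal_inv_of_pos (by positivity),
      mul_comm, ← div_eq_mul_inv] at h
    rw [ENNReal.div_le_iff (by simpa using hx'.ne') (by simp)] at h
    exact h.trans (by gcongr; exact le_self_add)
  have h2 : κ x (exceedSet γ 1) ≤ (M + 1) * ENNReal.ofReal 1 := by
    rw [ENNReal.ofReal_one, mul_one]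
    exact prob_le_one.trans le_add_self
  calc κ x (exceedSet γ 1) ≤ (M + 1) * ENNReal.ofReal (min 1 ((x : ℝ) ^ 2)) := by
        rcases le_total 1 ((x : ℝ) ^ 2) with h | h
        · rwa [min_eq_left h]
        · rwa [min_eq_right h]
    _ ≤ (M + 1) * ENNReal.ofReal (9 * expSq x) := by
        gcongr; exact min_one_sq_le_expSq hx'.le
    _ = _ := by rw [ENNReal.ofReal_mul (by norm_num), mul_assoc]

/-! ### The jumps are not summable -/

lemma measure_setOf_eventually_le {G : ℕ → Set Ω} {δ : ℝ≥0∞} (h : ∀ᶠ n in atTop, P (G n) ≤ δ) :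
    P {ω | ∀ᶠ n in atTop, ω ∈ G n} ≤ δ := by
  have e : {ω | ∀ᶠ n in atTop, ω ∈ G n} = ⋃ m : ℕ, ⋂ n ≥ m, G n := by
    ext ω; simp [eventually_atTop]
  have hmono : Monotone fun m : ℕ => ⋂ n ≥ m, G n := fun m m' hm =>
    biInter_mono (fun n (hn : m' ≤ n) => hm.trans hn) fun _ _ => Subset.rfl
  rw [e, hmono.measure_iUnion]
  refine iSup_le fun m => ?_
  obtain ⟨n, hn, hmn⟩ := (h.and (eventually_ge_atTop m)).exists
  exact (measure_mono (biInter_subset_of_mem hmn)).trans hn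

/-- `η` is chosen first, large enough for `η ^ (1 + α)` to beat a linear function and for the
Chebyshev ratio, of order `η ^ (-(1 + α))`, to be small. Then `m` is chosen depending on `η`, using
`m ^ (α - 1) → 0`. -/
lemma exists_scales (hα : 0 < α ∧ α < 1) {c₁ δ : ℝ} (hc₁ : 0 < c₁) (hδ : 0 < δ) (c₂ K : ℝ) :
    ∃ η m : ℝ, 0 < η ∧ 0 < m ∧ η * m⁻¹ ≤ 1 ∧ 64 * η * K + 1 ≤ c₁ * η ^ (1 + α) / 2 ∧
      c₂ * η ^ (1 + α) / (c₁ * η ^ (1 + α) / 4) ^ 2 < δ ∧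
      576 * (η * m⁻¹) ^ 2 * (c₁ * m ^ (1 + α)) < δ := by
  have h1 : Tendsto (fun η : ℝ => η ^ α) atTop atTop := tendsto_rpow_atTop hα.1
  have h2 : Tendsto (fun η : ℝ => 16 * c₂ / c₁ ^ 2 / η ^ (1 + α)) atTop (𝓝 0) :=
    tendsto_const_nhds.div_atTop (tendsto_rpow_atTop (by linarith [hα.1]))
  obtain ⟨η, ⟨hη1, hηK⟩, hηδ⟩ :
      ∃ η : ℝ, (1 ≤ η ∧ 2 / c₁ * (64 * |K| + 1) ≤ η ^ α) ∧
        16 * c₂ / c₁ ^ 2 / η ^ (1 + α) < δ := (((eventually_ge_atTop (1 : ℝ)).and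
    (h1.eventually_ge_atTop (2 / c₁ * (64 * |K| + 1)))).and (h2.eventually_lt_const hδ)).exists
  have hη0 : 0 < η := by linarith
  have h3 : Tendsto (fun m : ℝ => 576 * η ^ 2 * c₁ * m ^ (-(1 - α))) atTop (𝓝 0) := by
    have := (tendsto_rpow_neg_atTop (y := 1 - α) (by linarith [hα.2])).const_mul (576 * η ^ 2 * c₁)
    rwa [mul_zero] at this
  obtain ⟨m, hm, hmδ⟩ := ((eventually_ge_atTop η).and (h3.eventually_lt_const hδ)).exists
  have hm0 : 0 < m := by linarith
  have hp : 0 < η ^ (1 + α) := Real.rpow_pos_of_pos hη0 _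
  refine ⟨η, m, hη0, hm0, ?_, ?_, ?_, ?_⟩
  · rwa [← div_eq_mul_inv, div_le_one hm0]
  · rw [Real.rpow_add hη0, Real.rpow_one]
    have h4 : 64 * |K| + 1 ≤ c₁ * η ^ α / 2 := by
      calc 64 * |K| + 1 = c₁ * (2 / c₁ * (64 * |K| + 1)) / 2 := by field_simp
        _ ≤ _ := by gcongr
    have h5 := mul_le_mul_of_nonneg_left h4 hη0.le
    have h6 := mul_le_mul_of_nonneg_left (le_abs_self K) hη0.le
    nlinarith
  · refine lt_of_eq_of_lt ?_ hηδ
    field_simp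
    norm_num
  · refine lt_of_eq_of_lt ?_ hmδ
    rw [show -(1 - α) = (1 + α) - (2 : ℕ) by push_cast; ring, Real.rpow_sub hm0, Real.rpow_natCast]
    field_simp

lemma IsSpectrallyPositiveStable.jumpMeasure_le_null [IsProbabilityMeasure P]
    (hX : IsSpectrallyPositiveStable P α X) (hα : 0 < α ∧ α < 1) {T : ℝ≥0} (hT : 0 < T) (K : ℕ) :
    P {ω | jumpMeasure (X · ω) (Iic T) ≤ K} = 0 := by
  refine nonpos_iff_eq_zero.1 (ENNReal.le_of_forall_pos_le_add fun δ hδ _ => ?_)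
  rw [zero_add]
  have hpow : (0 : ℝ) < 2 ^ (1 + α) - 2 := by
    have := Real.rpow_lt_rpow_of_exponent_lt (x := 2) one_lt_two
      (show 1 < 1 + α by linarith [hα.1])
    rw [Real.rpow_one] at this
    linarith
  have hT' : (0 : ℝ) < T := hT
  obtain ⟨c, hc⟩ := exists_hasDerivAt_secondFun α
  have hδ2 : (0 : ℝ) < δ / 2 := half_pos (NNReal.coe_pos.2 hδ)
  obtain ⟨η, m, hη, hm, hηm, h1, h2, h3⟩ :=
    exists_scales hα (c₁ := T * (2 ^ (1 + α) - 2)) (by positivity) hδ2 (T * c) K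
  set b := T * (2 ^ (1 + α) - 2) * η ^ (1 + α) with hb
  have hb0 : 0 < b := by positivity
  set e := 576 * (η * m⁻¹) ^ 2 with he
  have hmean := hX.tendsto_integral_gridSum T hη.le
  have hvar : Tendsto (fun n : ℕ => ((n : ℝ) + 1) * secondFun α (T * η ^ (1 + α) / (n + 1)) /
      (b / 4) ^ 2) atTop (𝓝 (T * c * η ^ (1 + α) / (b / 4) ^ 2)) := by
    have := (tendsto_mul_comp_div hc (by norm_num [secondFun]) (T * η ^ (1 + α))).div_const
      ((b / 4) ^ 2)
    rwa [mul_right_comm] at this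
  have hmean' := (hX.tendsto_integral_gridSum T hm.le).const_mul e
  have hsub : {ω | jumpMeasure (X · ω) (Iic T) ≤ K} ≤ᵐ[P] {ω | ∀ᶠ n in atTop,
      ω ∈ {ω | gridSum (X · ω) T η n ≤ 64 * η * K + e * gridSum (X · ω) T m n}} := by
    filter_upwards [hX.levy.cadlag, hX.jump_nonneg] with ω hω1 hω2 hω
    have hω : jumpMeasure (X · ω) (Iic T) ≤ K := hω
    have hne : jumpMeasure (X · ω) (Iic T) ≠ ∞ :=
      ne_top_of_le_ne_top (ENNReal.natCast_ne_top K) hω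
    have := hω1.eventually_gridSum_le hω2 hne hη (inv_pos.2 hm) hηm
    rw [inv_inv] at this
    refine this.mono fun n hn => hn.trans ?_
    gcongr
    exact ENNReal.toReal_le_of_le_ofReal K.cast_nonneg (by rwa [ENNReal.ofReal_natCast])
  refine (measure_mono_ae hsub).trans (measure_setOf_eventually_le ?_)
  filter_upwards [hmean.eventually_const_lt (u := 3 / 4 * b) (by rw [hb] at *; linarith),
    hvar.eventually_lt_const h2,
    hmean'.eventually_lt_const (u := (δ : ℝ) / 2) (by rwa [mul_right_comm (T : ℝ)] at h3)]
    with n n1 n2 n3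
  -- The mean exceeds `3 / 4 * b`. When the error term is below `1`, `gridSum` is at most `64 * η *
  -- K + 1 ≤ b / 2`, hence a deviation of at least `b / 4`.
  have hincl : {ω | gridSum (X · ω) T η n ≤ 64 * η * K + e * gridSum (X · ω) T m n} ⊆
      {ω | b / 4 ≤ |gridSum (X · ω) T η n - ∫ ω, gridSum (X · ω) T η n ∂P|} ∪
      {ω | 1 ≤ e * gridSum (X · ω) T m n} := by
    intro ω hω
    by_cases h : 1 ≤ e * gridSum (X · ω) T m n
    · exact Or.inr h
    · left
      simp only [mem_ofPred_eq] at hω ⊢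
      rw [abs_sub_comm]
      refine le_trans ?_ (le_abs_self _)
      linarith
  have hcheb := meas_ge_le_variance_div_sq (hX.memLp_gridSum T hη.le n) (c := b / 4) (by linarith)
  have hmarkov := mul_meas_ge_le_integral_of_nonneg (μ := P) (Eventually.of_forall fun ω =>
    mul_nonneg (by positivity) (gridSum_nonneg (X · ω) T m n))
    ((hX.integrable_gridSum T hm.le n).const_mul e) 1
  rw [integral_const_mul, one_mul] at hmarkov
  calc _ ≤ P {ω | b / 4 ≤ |gridSum (X · ω) T η n - ∫ ω, gridSum (X · ω) T η n ∂P|} +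
        P {ω | 1 ≤ e * gridSum (X · ω) T m n} :=
        (measure_mono hincl).trans (measure_union_le _ _)
    _ ≤ ENNReal.ofReal (δ / 2) + ENNReal.ofReal (δ / 2) := by
        refine add_le_add (hcheb.trans (ENNReal.ofReal_le_ofReal ?_)) ?_
        · refine le_trans ?_ n2.le
          gcongr
          exact hX.variance_gridSum_le T hη.le n
        · rw [← ofReal_measureReal]
          exact ENNReal.ofReal_le_ofReal (hmarkov.trans n3.le)
    _ = δ := by
        rw [← ENNReal.ofReal_add hδ2.le hδ2.le, add_halves, ENNReal.ofReal_coe_nnreal]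

lemma IsSpectrallyPositiveStable.ae_tsum_jump_eq_top [IsProbabilityMeasure P]
    (hX : IsSpectrallyPositiveStable P α X) (hα : 0 < α ∧ α < 1) :
    ∀ᵐ ω ∂P, ∀ T : ℝ≥0, 0 < T → ∑' t : Iic T, ENNReal.ofReal (jump (X · ω) t) = ∞ := by
  have h : ∀ᵐ ω ∂P, ∀ j K : ℕ, ¬ jumpMeasure (X · ω) (Iic (1 / ((j : ℝ≥0) + 1))) ≤ K :=
    ae_all_iff.2 fun j => ae_all_iff.2 fun K => by
      rw [ae_iff]
      simpa using hX.jumpMeasure_le_null hα (T := 1 / ((j : ℝ≥0) + 1)) (by positivity) K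
  filter_upwards [h] with ω hω T hT
  obtain ⟨j, hj⟩ := exists_nat_one_div_lt (K := ℝ≥0) hT
  rw [← jumpMeasure_apply _ measurableSet_Iic]
  by_contra hne
  obtain ⟨K, hK⟩ := ENNReal.exists_nat_gt hne
  exact hω j K ((measure_mono (Iic_subset_Iic.2 hj.le)).trans hK.le)

/-! ### The Hölder constants are bounded -/

lemma IsSpectrallyPositiveStable.lintegral_liminf_gridSum_lt_top [IsProbabilityMeasure P]
    (hX : IsSpectrallyPositiveStable P α X) (T : ℝ≥0) :
    ∫⁻ ω, liminf (fun n => ENNReal.ofReal (gridSum (X · ω) T 1 n)) atTop ∂P < ∞ := by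
  refine (lintegral_liminf_le fun n => (hX.measurable_gridSum T 1 n).ennreal_ofReal).trans_lt ?_
  have h := ENNReal.tendsto_ofReal (hX.tendsto_integral_gridSum T zero_le_one)
  simp_rw [fun n => ofReal_integral_eq_lintegral_ofReal (hX.integrable_gridSum T zero_le_one n)
    (Eventually.of_forall fun ω => gridSum_nonneg (X · ω) T 1 n)] at h
  rw [h.liminf_eq]
  exact ENNReal.ofReal_lt_top

/-- Measurability of `g` is deduced from its being a version of a conditional expectation, so that
of the jump size at a listed time need not be proved separately. -/
lemma measure_inter_eq_setLIntegral_of_condExp {Ω : Type*} {m m₀ : MeasurableSpace Ω}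
    {P : Measure Ω} [IsProbabilityMeasure P] (hm : m ≤ m₀) {E B : Set Ω} (hE : MeasurableSet E)
    (hB : MeasurableSet[m] B) {g : Ω → ℝ≥0∞} (hg : ∀ ω, g ω ≤ 1) (h : P⟦E | m⟧ =ᵐ[P] fun ω => (g ω).toReal) :
    AEMeasurable g P ∧ P (E ∩ B) = ∫⁻ ω in B, g ω ∂P := by
  have hgt : ∀ ω, g ω ≠ ∞ := fun ω => ne_top_of_le_ne_top ENNReal.one_ne_top (hg ω)
  have hmeas : AEMeasurable g P := by
    refine ⟨fun ω => ENNReal.ofReal ((P⟦E | m⟧) ω),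
      (stronglyMeasurable_condExp.mono hm).measurable.ennreal_ofReal, ?_⟩
    filter_upwards [h] with ω hω
    rw [hω, ENNReal.ofReal_toReal (hgt ω)]
  refine ⟨hmeas, ?_⟩
  have h1 := setIntegral_condExp hm ((integrable_const (1 : ℝ)).indicator (μ := P) hE) hB
  rw [integral_congr_ae (ae_restrict_of_ae h), integral_toReal hmeas.restrict
    (Eventually.of_forall fun ω => (hgt ω).lt_top)] at h1
  have h2 : ∫⁻ ω in B, g ω ∂P ≠ ∞ := by
    refine ne_top_of_le_ne_top (measure_ne_top P B) ?_
    calc _ ≤ ∫⁻ _ in B, 1 ∂P := lintegral_mono hg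
      _ = P B := by simp
  rw [← ENNReal.toReal_eq_toReal_iff' (measure_ne_top _ _) h2, h1, integral_indicator_const _ hE,
    smul_eq_mul, mul_one, Measure.real, Measure.restrict_apply hE]

lemma processSigma_le (hX : ∀ t, Measurable (X t)) : processSigma X ≤ ‹MeasurableSpace Ω› :=
  iSup_le fun t => (hX t).comap_le

/-- The conditional law of a single mark in a list of conditionally independent marks. -/
lemma condExp_single_mark {Ω : Type*} {m m₀ : MeasurableSpace Ω} {P : Measure Ω}
    {κ : Kernel ℝ≥0 MarkPath} [IsMarkovKernel κ]
    {W : ℕ → Ω → MarkPath} {J : ℕ → Ω → ℝ≥0}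
    (h : ∀ (N : ℕ) (A : ℕ → Set MarkPath), (∀ n, MeasurableSet (A n)) →
      P⟦{ω | ∀ n < N, W n ω ∈ A n} | m⟧ =ᵐ[P]
        fun ω => ∏ n ∈ Finset.range N, (κ (J n ω)).real (A n))
    (n : ℕ) {A : Set MarkPath} (hA : MeasurableSet A) :
    P⟦{ω | W n ω ∈ A} | m⟧ =ᵐ[P] fun ω => (κ (J n ω) A).toReal := by
  have h1 := h (n + 1) (fun k => if k = n then A else univ) fun k => by
    split_ifs <;> simp [hA]
  have e1 : {ω | ∀ k < n + 1, W k ω ∈ (if k = n then A else univ)} = {ω | W n ω ∈ A} := by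
    ext ω
    simp only [mem_ofPred_eq]
    refine ⟨fun h => by simpa using h n n.lt_succ_self, fun h k _ => ?_⟩
    split_ifs with hk
    · rwa [hk]
    · trivial
  rw [e1] at h1
  refine h1.trans (Eventually.of_forall fun ω => ?_)
  dsimp only
  rw [Finset.prod_eq_single n (fun k _ hk => by simp [hk]) (by simp)]
  simp [Measure.real]

lemma ae_iSup_holderConst_lt_top [IsProbabilityMeasure P] {q γ : ℝ} (hγ : 0 < γ ∧ γ < q)
    {κ : Kernel ℝ≥0 MarkPath} [IsMarkovKernel κ] (hκ : IsSelfSimilarMarking q κ)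
    (hmom : ∀ p : ℝ, 0 < p → ∫⁻ f, holderConst γ 1 f.1 ^ p ∂(κ 1) < ∞)
    (hX : IsSpectrallyPositiveStable P α X) {Z : ℝ≥0 → Ω → MarkPath} (hZ : IsMarking P κ X Z) :
    ∀ᵐ ω ∂P, ∀ T : ℝ≥0,
      (⨆ (t : ℝ≥0) (_ : t ≤ T), holderConst γ (jump (X · ω) t) (Z t ω).1) < ∞ := by
  obtain ⟨τ, hτm, hτ, hZm, hcond⟩ := hZ
  have hm := processSigma_le hX.levy.measurable
  obtain ⟨C, hC, hCκ⟩ := hκ.exists_exceedSet_le hγ hmom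
  set J : ℕ → Ω → ℝ≥0 := fun n ω => (jump (X · ω) (τ n ω)).toNNReal with hJ
  have hlaw : ∀ (n : ℕ) {A : Set MarkPath}, MeasurableSet A → ∀ {B : Set Ω},
      MeasurableSet[processSigma X] B →
      AEMeasurable (fun ω => κ (J n ω) A) P ∧
      P ({ω | Z (τ n ω) ω ∈ A} ∩ B) = ∫⁻ ω in B, κ (J n ω) A ∂P := fun n A hA B hB =>
    measure_inter_eq_setLIntegral_of_condExp hm (hZm n hA) hB (fun _ => prob_le_one)
      (condExp_single_mark hcond n hA)
  have hfin : ∀ᵐ ω ∂P, ∀ n, ∃ k : ℕ, Z (τ n ω) ω ∉ exceedSet γ k := by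
    refine ae_all_iff.2 fun n => ?_
    have h := (hlaw n (MeasurableSet.iInter fun k : ℕ => measurableSet_exceedSet γ k)
      MeasurableSet.univ).2
    simp_rw [hκ.iInter_exceedSet hγ.1 hmom, lintegral_zero, inter_univ] at h
    rw [ae_iff]
    simpa using h
  have hBC : ∀ᵐ ω ∂P, ∀ j : ℕ, ∀ᶠ n in atTop,
      ¬ (Z (τ n ω) ω ∈ exceedSet γ 1 ∧ τ n ω ≤ j) := by
    refine ae_all_iff.2 fun j => ?_
    have hBm : ∀ n, MeasurableSet[processSigma X] {ω | τ n ω ≤ j} := fun n =>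
      hτm n measurableSet_Iic
    have hA := measurableSet_exceedSet γ 1
    have hsum : ∑' n, P ({ω | Z (τ n ω) ω ∈ exceedSet γ 1} ∩ {ω | τ n ω ≤ j}) ≠ ∞ := by
      have e : ∀ n, P ({ω | Z (τ n ω) ω ∈ exceedSet γ 1} ∩ {ω | τ n ω ≤ j}) =
          ∫⁻ ω, {ω | τ n ω ≤ j}.indicator (fun ω => κ (J n ω) (exceedSet γ 1)) ω ∂P := fun n => by
        rw [(hlaw n hA (hBm n)).2, lintegral_indicator (hm _ (hBm n))]
      simp_rw [e]
      rw [← lintegral_tsum fun n => (hlaw n hA (hBm n)).1.indicator (hm _ (hBm n))]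
      refine ne_top_of_le_ne_top (ENNReal.mul_ne_top hC
        (hX.lintegral_liminf_gridSum_lt_top j).ne) ?_
      rw [← lintegral_const_mul' _ _ hC]
      refine lintegral_mono_ae ?_
      filter_upwards [hτ, hX.levy.cadlag, hX.jump_nonneg] with ω hω1 hω2 hω3
      let F : ℝ≥0 → ℝ≥0∞ := (Iic (j : ℝ≥0)).indicator
        fun t => ENNReal.ofReal (expSq (jump (X · ω) t))
      -- Injectivity of the list ensures that each jump time is counted at most once, so the sum is
      -- controlled by the sum of `expSq` over all jumps up to `j`.
      calc _ ≤ ∑' n, C * F (τ n ω) := by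
            refine ENNReal.tsum_le_tsum fun n => ?_
            by_cases h : τ n ω ≤ j
            · have h' : τ n ω ∈ Iic (j : ℝ≥0) := h
              rw [indicator_of_mem (by exact h), show F (τ n ω) = _ from indicator_of_mem h' _]
              refine (hCκ _).trans_eq ?_
              rw [hJ, Real.coe_toNNReal _ (hω3 _)]
            · rw [indicator_of_notMem (by exact h)]
              exact zero_le
        _ = C * ∑' n, F (τ n ω) := ENNReal.tsum_mul_left
        _ ≤ C * ∑' t, F t := by
            gcongr
            exact ENNReal.tsum_comp_le_tsum_of_injective hω1.1 F
        _ ≤ _ := by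
            gcongr
            rw [← tsum_subtype]
            exact tsum_expSq_jump_le_liminf hω2 j
    have h0 := measure_setOfPred_frequently_eq_zero hsum
    rw [ae_iff]
    simp only [not_eventually, not_not]
    exact h0
  filter_upwards [hτ, hfin, hBC] with ω hω1 hω2 hω3 T
  obtain ⟨j, hj⟩ := exists_nat_ge T
  choose k hk using hω2
  obtain ⟨N, hN⟩ := eventually_atTop.1 (hω3 j)
  -- Marks listed from `N` on have constant at most `1`; the finitely many earlier ones are bounded
  -- by their own `k n`.
  refine lt_of_le_of_lt (b := ENNReal.ofReal (1 + ∑ n ∈ Finset.range N, (k n : ℝ))) ?_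
    ENNReal.ofReal_lt_top
  refine iSup₂_le fun t ht => ?_
  by_cases hjump : jump (X · ω) t = 0
  · rw [hjump]
    -- Without a jump the interval is `[0, 0]` and the supremum is over no pair.
    exact iSup_le fun r => iSup_le fun s => iSup_le fun h => absurd (h.2.1.trans_le h.2.2) h.1.not_gt
  obtain ⟨n, rfl⟩ := hω1.2 t hjump
  have hnn : ∀ i ∈ Finset.range N, (0 : ℝ) ≤ k i := fun i _ => (k i).cast_nonneg
  rcases lt_or_ge n N with h | h
  · refine (holderConst_le_of_notMem_exceedSet hγ.1 (hk n) _).trans (ENNReal.ofReal_le_ofReal ?_)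
    have := Finset.single_le_sum hnn (Finset.mem_range.2 h)
    linarith
  · refine (holderConst_le_of_notMem_exceedSet hγ.1 (fun h' => hN n h ⟨h', ht.trans hj⟩)
      _).trans (ENNReal.ofReal_le_ofReal ?_)
    have := Finset.sum_nonneg hnn
    linarith

end MarkedStable

theorem proposition5 {Ω : Type*} [MeasurableSpace Ω] (P : Measure Ω) [IsProbabilityMeasure P]
    (α q γ : ℝ) (hα : 0 < α ∧ α < 1) (hq : α < q) (hγ : 0 < γ ∧ γ < q)
    (κ : Kernel ℝ≥0 MarkedStable.MarkPath) [IsMarkovKernel κ]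
    (hκ : MarkedStable.IsSelfSimilarMarking q κ)
    (hmom : ∀ p : ℝ, 0 < p → ∫⁻ f, MarkedStable.holderConst γ 1 f.1 ^ p ∂(κ 1) < ∞)
    (hc : 0 < MarkedStable.crossingConst α q κ)
    (X : ℝ≥0 → Ω → ℝ) (hX : MarkedStable.IsSpectrallyPositiveStable P α X)
    (Z : ℝ≥0 → Ω → MarkedStable.MarkPath) (hZ : MarkedStable.IsMarking P κ X Z) :
    ∀ᵐ ω ∂P, ∀ T : ℝ≥0, 0 < T →
      (⨆ (t : ℝ≥0) (_ : t ≤ T),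
        MarkedStable.holderConst γ (MarkedStable.jump (fun s => X s ω) t) (Z t ω).1) < ∞ ∧
      ∑' t : Iic T, ENNReal.ofReal (MarkedStable.jump (fun s => X s ω) t) = ∞ := by
  filter_upwards [MarkedStable.ae_iSup_holderConst_lt_top hγ hκ hmom hX hZ,
    hX.ae_tsum_jump_eq_top hα] with ω h1 h2 T hT
  exact ⟨h1 T, h2 T hT⟩
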